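/- Let $K$ be an algebraically closed field, let $J=\begin{pmatrix}0&I_2\\-I_2&0\end{pmatrix}$, and put $$SP_4(K)=\{M\in GL_4(K): M^tJM=J\},\qquad PSP_4(K)=\{M\in GL_4(K): \exists \lambda\in K^*,\ M^tJM=\lambda J\}.$$ Let $G$ be an algebraic (i.e. Zariski closed) subgroup of $GL_4(K)$ that is a finite extension of $SP_4(K)$, i.e. $G$ contains $SP_4(K)$ as a subgroup of finite index. Then there is an integer $p\ge 1$ such that $$G=\{M\in M_4(K): \exists \lambda\in \mathbb{U}_p,\ M^tJM=\lambda J\},$$ where $\mathbb{U}_p=\{\lambda\in K:\lambda^p=1\}$ is the set of $p$-th roots of unity in $K$. In particular, $G\subset PSP_4(K)$. -/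

import Mathlib

open Matrix

/-- The standard symplectic form `J = [[0, I_n], [-I_n, 0]]`, as a `2n × 2n` matrix with rows and
columns indexed by `Fin n ⊕ Fin n`. -/
def stdJ (n : ℕ) (K : Type*) [Field K] : Matrix (Fin n ⊕ Fin n) (Fin n ⊕ Fin n) K :=
  Matrix.fromBlocks 0 1 (-1) 0

/-- The group `SP_{2n}(K)` of matrices `M ∈ GL_{2n}(K)` with `MᵀJM = J`. -/
def SP (n : ℕ) (K : Type*) [Field K] : Subgroup (GL (Fin n ⊕ Fin n) K) where
  carrier := {M | (M.val)ᵀ * stdJ n K * M.val = stdJ n K}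
  one_mem' := by simp
  mul_mem' := by
    intro a b ha hb
    simp only [Set.mem_setOf_eq] at ha hb ⊢
    calc ((a * b).val)ᵀ * stdJ n K * (a * b).val
        = (b.val)ᵀ * ((a.val)ᵀ * stdJ n K * a.val) * b.val := by
          simp [Matrix.transpose_mul, Matrix.mul_assoc]
      _ = stdJ n K := by rw [ha, hb]
  inv_mem' := by
    intro a ha
    simp only [Set.mem_setOf_eq] at ha ⊢
    have h : a.val * (a⁻¹).val = 1 := a.mul_inv
    have h' : ((a⁻¹).val)ᵀ * (a.val)ᵀ = 1 := by rw [← Matrix.transpose_mul, h]; simp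
    calc ((a⁻¹).val)ᵀ * stdJ n K * (a⁻¹).val
        = ((a⁻¹).val)ᵀ * ((a.val)ᵀ * stdJ n K * a.val) * (a⁻¹).val := by rw [ha]
      _ = (((a⁻¹).val)ᵀ * (a.val)ᵀ) * stdJ n K * (a.val * (a⁻¹).val) := by
          simp only [Matrix.mul_assoc]
      _ = stdJ n K := by rw [h, h']; simp

/-- The group `PSP_{2n}(K)` of matrices `M ∈ GL_{2n}(K)` with `MᵀJM = λJ` for some `λ ∈ K^*`. -/
def PSP (n : ℕ) (K : Type*) [Field K] : Subgroup (GL (Fin n ⊕ Fin n) K) where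
  carrier := {M | ∃ c : K, c ≠ 0 ∧ (M.val)ᵀ * stdJ n K * M.val = c • stdJ n K}
  one_mem' := ⟨1, one_ne_zero, by simp⟩
  mul_mem' := by
    rintro a b ⟨c, hc, ha⟩ ⟨d, hd, hb⟩
    refine ⟨c * d, mul_ne_zero hc hd, ?_⟩
    calc ((a * b).val)ᵀ * stdJ n K * (a * b).val
        = (b.val)ᵀ * ((a.val)ᵀ * stdJ n K * a.val) * b.val := by
          simp [Matrix.transpose_mul, Matrix.mul_assoc]
      _ = c • ((b.val)ᵀ * stdJ n K * b.val) := by rw [ha]; simp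
      _ = (c * d) • stdJ n K := by rw [hb, smul_smul]
  inv_mem' := by
    rintro a ⟨c, hc, ha⟩
    refine ⟨c⁻¹, inv_ne_zero hc, ?_⟩
    have h : a.val * (a⁻¹).val = 1 := a.mul_inv
    have h' : ((a⁻¹).val)ᵀ * (a.val)ᵀ = 1 := by rw [← Matrix.transpose_mul, h]; simp
    calc ((a⁻¹).val)ᵀ * stdJ n K * (a⁻¹).val
        = c⁻¹ • (((a⁻¹).val)ᵀ * (c • stdJ n K) * (a⁻¹).val) := by
          simp [smul_smul, inv_mul_cancel₀ hc]
      _ = c⁻¹ • ((((a⁻¹).val)ᵀ * (a.val)ᵀ) * stdJ n K * (a.val * (a⁻¹).val)) := by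
          rw [← ha]; simp only [Matrix.mul_assoc]
      _ = c⁻¹ • stdJ n K := by rw [h, h']; simp

/-- The set of all `2n × 2n` matrices `M` (not assumed invertible) such that `MᵀJM = λJ` for some
`λ ∈ K` with `λ ^ p = 1`. -/
def rootMultiplierSet (n : ℕ) (K : Type*) [Field K] (p : ℕ) :
    Set (Matrix (Fin n ⊕ Fin n) (Fin n ⊕ Fin n) K) :=
  {M | ∃ c : K, c ^ p = 1 ∧ Mᵀ * stdJ n K * M = c • stdJ n K}

/-- A subgroup of `GL(K)` is algebraic if it is Zariski closed in `GL(K)`: it is cut out in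
`GL(K)` by a set of polynomials in the matrix entries. (Denominators `det` can be cleared, so
allowing `1 / det` as a further variable would give the same closed sets.) -/
def IsAlgebraicSubgroup {ι K : Type*} [Fintype ι] [DecidableEq ι] [Field K]
    (G : Subgroup (GL ι K)) : Prop :=
  ∃ S : Set (MvPolynomial (ι × ι) K), ∀ g : GL ι K,
    g ∈ G ↔ ∀ f ∈ S, MvPolynomial.eval (fun ij : ι × ι => g.val ij.1 ij.2) f = 0

/-- `G` is a finite extension of `H`: it contains `H` as a subgroup of finite index. (Normality
of `H` in `G` is not demanded.) -/
def IsFiniteExtensionOf {Γ : Type*} [Group Γ] (G H : Subgroup Γ) : Prop :=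
  H ≤ G ∧ (H.subgroupOf G).FiniteIndex

/-! Fix g in G and let A = gᵀJg. Conjugating by g the symplectic transvections 1 + t v(Jv)ᵀ gives a
homomorphism from the infinite additive group K to G; as SP has finite index, some t ≠ 0 lands in
SP. That transvection then preserves A, which forces Av to be parallel to Jv. This holds for every
v, so A = cJ and g is a similitude (`le_PSP_of_isFiniteExtensionOf`). The multiplier g ↦ c is a
homomorphism to Kˣ whose kernel on G is SP, so its image is finite, hence is the group of p-th roots
of unity with p its order. Since G contains the kernel, it contains every similitude with such a
multiplier. -/

section Transvections

variable {ι K : Type*} [Field K]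

theorem exists_eq_smul_of_vecMulVec_comm {a b : ι → K} (ha : a ≠ 0)
    (h : vecMulVec b a = vecMulVec a b) : ∃ c : K, b = c • a := by
  obtain ⟨j, hj⟩ := Function.ne_iff.mp ha
  refine ⟨b j / a j, funext fun i => ?_⟩
  have hij := congrFun (congrFun h i) j
  simp only [vecMulVec_apply, Pi.zero_apply] at hij hj
  simp only [Pi.smul_apply, smul_eq_mul]
  field_simp
  linear_combination hij

variable [Fintype ι] [DecidableEq ι]

/-- The rank-one unipotent one-parameter group `t ↦ 1 + t v wᵀ`, for `w ⬝ v = 0`. -/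
def transvectionHom (v w : ι → K) (h : w ⬝ᵥ v = 0) : Multiplicative K →* GL ι K :=
  MonoidHom.toHomUnits
    { toFun := fun t => 1 + t.toAdd • vecMulVec v w
      map_one' := by simp
      map_mul' := fun s t => by
        simp only [toAdd_mul, Matrix.add_mul, Matrix.mul_add, Matrix.one_mul, Matrix.mul_one,
          Matrix.smul_mul, Matrix.mul_smul, vecMulVec_mul_vecMulVec, h, zero_smul,
          vecMulVec_zero, smul_zero, add_zero, add_smul]
        abel }

theorem coe_transvectionHom (v w : ι → K) (h : w ⬝ᵥ v = 0) (t : Multiplicative K) :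
    (transvectionHom v w h t).val = 1 + t.toAdd • vecMulVec v w := rfl

/-- The effect of a transvection on an alternating form. -/
theorem transpose_mul_mul_transvection {A : Matrix ι ι K} (hA : Aᵀ = -A) {v : ι → K}
    (hv : v ⬝ᵥ A *ᵥ v = 0) (w : ι → K) (t : K) :
    (1 + t • vecMulVec v w)ᵀ * A * (1 + t • vecMulVec v w) =
      A + t • (vecMulVec (A *ᵥ v) w - vecMulVec w (A *ᵥ v)) := by
  have h : v ᵥ* A = -(A *ᵥ v) := by
    rw [← mulVec_transpose, hA, neg_mulVec]
  have h₁ : vecMulVec w v * A = -vecMulVec w (A *ᵥ v) := by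
    rw [vecMulVec_mul, h, vecMulVec_neg]
  have h₂ : vecMulVec w (A *ᵥ v) * vecMulVec v w = 0 := by
    rw [vecMulVec_mul_vecMulVec, dotProduct_comm, hv, zero_smul, vecMulVec_zero]
  simp only [transpose_add, transpose_one, transpose_smul, transpose_vecMulVec, Matrix.add_mul,
    Matrix.mul_add, Matrix.one_mul, Matrix.mul_one, Matrix.smul_mul, Matrix.mul_smul,
    mul_vecMulVec A, h₁, Matrix.neg_mul, h₂, neg_zero, smul_zero, add_zero, smul_neg, smul_sub]
  abel

/-- A matrix for which every vector is an eigenvector is scalar. -/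
theorem exists_eq_smul_one_of_forall_mulVec {A : Matrix ι ι K}
    (h : ∀ v : ι → K, v ≠ 0 → ∃ c : K, A *ᵥ v = c • v) : ∃ c : K, A = c • 1 := by
  obtain ⟨c, hc⟩ := (Matrix.toLin' A).exists_eq_smul_id_of_forall_notLinearIndependent fun v => by
    by_cases hv : v = 0
    · simp [hv, linearIndependent_fin2]
    · obtain ⟨c, hc⟩ := h v hv
      rw [LinearIndependent.pair_iff' hv]
      push Not
      exact ⟨c, by simp [hc]⟩
  refine ⟨c, Matrix.toLin'.injective ?_⟩
  rw [hc, map_smul, Matrix.toLin'_one]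
  rfl

end Transvections

section Symplectic

variable {n : ℕ} {K : Type*} [Field K]

theorem stdJ_transpose : (stdJ n K)ᵀ = -stdJ n K := by
  simp [stdJ, fromBlocks_transpose, fromBlocks_neg]

theorem stdJ_mul_stdJ : stdJ n K * stdJ n K = -1 := by
  rw [stdJ, fromBlocks_multiply, ← fromBlocks_one, fromBlocks_neg]
  simp

theorem stdJ_ne_zero [NeZero n] : stdJ n K ≠ 0 := by
  intro h
  have := congrFun (congrFun h (Sum.inl 0)) (Sum.inr 0)
  simp [stdJ] at this

theorem dotProduct_stdJ_mulVec_self (v : Fin n ⊕ Fin n → K) : v ⬝ᵥ stdJ n K *ᵥ v = 0 := by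
  simp only [stdJ, dotProduct, fromBlocks_mulVec, Fintype.sum_sum_type, Sum.elim_inl,
    Sum.elim_inr, zero_mulVec, one_mulVec, neg_mulVec, zero_add, add_zero, Pi.neg_apply,
    Function.comp_apply]
  simp [mul_comm]

theorem mem_SP {g : GL (Fin n ⊕ Fin n) K} :
    g ∈ SP n K ↔ g.valᵀ * stdJ n K * g.val = stdJ n K := Iff.rfl

theorem mem_PSP {g : GL (Fin n ⊕ Fin n) K} :
    g ∈ PSP n K ↔ ∃ c : K, c ≠ 0 ∧ g.valᵀ * stdJ n K * g.val = c • stdJ n K := Iff.rfl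

/-- Conjugation by g transports J to the form gᵀJg, so the condition becomes one on x alone. -/
theorem conj_mem_SP_iff (g x : GL (Fin n ⊕ Fin n) K) :
    g * x * g⁻¹ ∈ SP n K ↔
      x.valᵀ * (g.valᵀ * stdJ n K * g.val) * x.val = g.valᵀ * stdJ n K * g.val := by
  have h : g⁻¹.valᵀ * g.valᵀ = 1 := by
    rw [← transpose_mul, ← Units.val_mul, mul_inv_cancel, Units.val_one, transpose_one]
  have h' : g.valᵀ * g⁻¹.valᵀ = 1 := by
    rw [← transpose_mul, ← Units.val_mul, inv_mul_cancel, Units.val_one, transpose_one]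
  have hg : g.val * g⁻¹.val = 1 := by rw [← Units.val_mul, mul_inv_cancel, Units.val_one]
  have hg' : g⁻¹.val * g.val = 1 := by rw [← Units.val_mul, inv_mul_cancel, Units.val_one]
  rw [mem_SP]
  simp only [Units.val_mul, transpose_mul]
  constructor
  · intro H
    calc x.valᵀ * (g.valᵀ * stdJ n K * g.val) * x.val
        = (g.valᵀ * g⁻¹.valᵀ) * x.valᵀ * g.valᵀ * stdJ n K * g.val * x.val *
            (g⁻¹.val * g.val) := by rw [h', hg']; simp only [Matrix.mul_assoc, Matrix.one_mul,
              Matrix.mul_one]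
      _ = g.valᵀ * (g⁻¹.valᵀ * (x.valᵀ * g.valᵀ) * stdJ n K * (g.val * x.val * g⁻¹.val)) *
            g.val := by simp only [Matrix.mul_assoc]
      _ = _ := by rw [H]
  · intro H
    calc g⁻¹.valᵀ * (x.valᵀ * g.valᵀ) * stdJ n K * (g.val * x.val * g⁻¹.val)
        = g⁻¹.valᵀ * (x.valᵀ * (g.valᵀ * stdJ n K * g.val) * x.val) * g⁻¹.val := by
          simp only [Matrix.mul_assoc]
      _ = (g⁻¹.valᵀ * g.valᵀ) * stdJ n K * (g.val * g⁻¹.val) := by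
          rw [H]; simp only [Matrix.mul_assoc]
      _ = stdJ n K := by rw [h, hg, Matrix.one_mul, Matrix.mul_one]

theorem stdJ_mulVec_dotProduct_self (v : Fin n ⊕ Fin n → K) : (stdJ n K *ᵥ v) ⬝ᵥ v = 0 := by
  rw [dotProduct_comm, dotProduct_stdJ_mulVec_self]

theorem transvectionHom_mem_SP (v : Fin n ⊕ Fin n → K) (t : Multiplicative K) :
    transvectionHom v (stdJ n K *ᵥ v) (stdJ_mulVec_dotProduct_self v) t ∈ SP n K := by
  rw [mem_SP, coe_transvectionHom,
    transpose_mul_mul_transvection stdJ_transpose (dotProduct_stdJ_mulVec_self v)]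
  simp

/-- If, for each `v`, the element `g` conjugates some nontrivial symplectic transvection along `v`
into the symplectic group, then `g` is a symplectic similitude. -/
theorem mem_PSP_of_conj_transvection_mem [NeZero n] {g : GL (Fin n ⊕ Fin n) K}
    (h : ∀ v : Fin n ⊕ Fin n → K, ∃ t : Multiplicative K, t ≠ 1 ∧
      g * transvectionHom v (stdJ n K *ᵥ v) (stdJ_mulVec_dotProduct_self v) t * g⁻¹ ∈ SP n K) :
    g ∈ PSP n K := by
  set A := g.valᵀ * stdJ n K * g.val with hA
  have hAt : Aᵀ = -A := by
    simp [hA, transpose_mul, stdJ_transpose, Matrix.mul_assoc]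
  have hAv (v : Fin n ⊕ Fin n → K) : v ⬝ᵥ A *ᵥ v = 0 := by
    rw [hA, ← mulVec_mulVec, ← mulVec_mulVec, dotProduct_mulVec, vecMul_transpose,
      dotProduct_stdJ_mulVec_self]
  -- Since J⁻¹ = -J, this says A = cJ; the eigenvector condition at v is that Av is a multiple of
  -- Jv.
  obtain ⟨c, hc⟩ : ∃ c : K, -(stdJ n K) * A = c • 1 := by
    refine exists_eq_smul_one_of_forall_mulVec fun v hv => ?_
    have hJv : -(stdJ n K) *ᵥ (stdJ n K *ᵥ v) = v := by
      rw [mulVec_mulVec, Matrix.neg_mul, stdJ_mul_stdJ, neg_neg, one_mulVec]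
    obtain ⟨t, ht, hmem⟩ := h v
    rw [conj_mem_SP_iff, coe_transvectionHom, ← hA, transpose_mul_mul_transvection hAt (hAv v),
      add_eq_left, smul_eq_zero, or_iff_right (by simpa using ht), sub_eq_zero] at hmem
    obtain ⟨c, hc⟩ := exists_eq_smul_of_vecMulVec_comm
      (fun h0 => hv (by rw [← hJv, h0, mulVec_zero])) hmem
    exact ⟨c, by rw [← mulVec_mulVec, hc, mulVec_smul, hJv]⟩
  have hAc : A = c • stdJ n K := by
    calc A = stdJ n K * (-(stdJ n K) * A) := by
          rw [← Matrix.mul_assoc, Matrix.mul_neg, stdJ_mul_stdJ, neg_neg, Matrix.one_mul]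
      _ = c • stdJ n K := by rw [hc, Matrix.mul_smul, Matrix.mul_one]
  refine mem_PSP.mpr ⟨c, ?_, hAc⟩
  rintro rfl
  have hdet : IsUnit A := by
    refine (((Matrix.isUnit_transpose _).mpr g.isUnit).mul ?_).mul g.isUnit
    exact IsUnit.of_mul_eq_one (-(stdJ n K)) (by rw [Matrix.mul_neg, stdJ_mul_stdJ, neg_neg])
  rw [hAc, zero_smul] at hdet
  exact stdJ_ne_zero (n := n) (K := K) (by
    rw [← Matrix.mul_one (stdJ n K), ← isUnit_zero_iff.mp hdet, Matrix.mul_zero])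

theorem le_PSP_of_isFiniteExtensionOf [NeZero n] [Infinite K]
    {G : Subgroup (GL (Fin n ⊕ Fin n) K)} (hG : IsFiniteExtensionOf G (SP n K)) :
    G ≤ PSP n K := by
  obtain ⟨hle, hfin⟩ := hG
  intro g hg
  refine mem_PSP_of_conj_transvection_mem fun v => ?_
  let τ : Multiplicative K →* G := (MulAut.conj (⟨g, hg⟩ : G)).toMonoidHom.comp
    ((transvectionHom v (stdJ n K *ᵥ v) (stdJ_mulVec_dotProduct_self v)).codRestrict G
      fun t => hle (transvectionHom_mem_SP v t))
  have hne : ((SP n K).subgroupOf G).comap τ ≠ ⊥ := by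
    intro hbot
    have hidx := congrArg Subgroup.index hbot
    -- Index 0 encodes infinite index.
    rw [Subgroup.index_comap, Subgroup.index_bot, Nat.card_eq_zero_of_infinite] at hidx
    exact hfin.index_ne_zero (Subgroup.index_eq_zero_of_relIndex_eq_zero hidx)
  obtain ⟨t, ht⟩ := Subgroup.ne_bot_iff_exists_ne_one.mp hne
  exact ⟨t, fun h => ht (Subtype.ext h), t.2⟩

theorem smul_stdJ_injective [NeZero n] : Function.Injective fun c : K => c • stdJ n K :=
  smul_left_injective K stdJ_ne_zero

/-- The multiplier `c` of a symplectic similitude, given by `MᵀJM = cJ`, is multiplicative. -/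
theorem exists_similitudeMultiplier (n : ℕ) [NeZero n] (K : Type*) [Field K] :
    ∃ μ : PSP n K →* Kˣ, ∀ g : PSP n K,
      g.1.valᵀ * stdJ n K * g.1.val = (μ g : K) • stdJ n K := by
  choose μ hμ using fun g : PSP n K => (mem_PSP.mp g.2).imp fun _ h => h.2
  refine ⟨MonoidHom.toHomUnits
    { toFun := μ
      map_one' := smul_stdJ_injective (n := n) ?_
      map_mul' := fun a b => smul_stdJ_injective (n := n) ?_ }, hμ⟩
  · simp [← hμ]
  · simp only [← hμ (a * b)]
    calc ((a * b : PSP n K).1.val)ᵀ * stdJ n K * (a * b : PSP n K).1.val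
        = b.1.valᵀ * (a.1.valᵀ * stdJ n K * a.1.val) * b.1.val := by
          simp [transpose_mul, Matrix.mul_assoc]
      _ = (μ a * μ b) • stdJ n K := by rw [hμ, Matrix.mul_smul, Matrix.smul_mul, hμ, smul_smul]

theorem isUnit_of_transpose_mul_stdJ_mul {M : Matrix (Fin n ⊕ Fin n) (Fin n ⊕ Fin n) K} {c : K}
    (hc : c ≠ 0) (h : Mᵀ * stdJ n K * M = c • stdJ n K) : IsUnit M := by
  refine IsUnit.of_mul_eq_one_right (-(c⁻¹ • stdJ n K * (Mᵀ * stdJ n K))) ?_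
  rw [Matrix.neg_mul, Matrix.mul_assoc, h, Matrix.smul_mul, Matrix.mul_smul, smul_smul,
    inv_mul_cancel₀ hc, one_smul, stdJ_mul_stdJ, neg_neg]

/-- A finite subgroup of `Kˣ` consists of all roots of unity of exponent its order. -/
theorem eq_rootsOfUnity_natCard (H : Subgroup Kˣ) [Finite H] :
    H = rootsOfUnity (Nat.card H) K := by
  have : NeZero (Nat.card H) := ⟨Nat.card_pos.ne'⟩
  refine Subgroup.eq_of_le_of_card_ge (fun x hx => ?_) ?_
  · rw [mem_rootsOfUnity]
    exact congrArg Subtype.val (pow_card_eq_one' (x := (⟨x, hx⟩ : H)))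
  · exact card_rootsOfUnity K (Nat.card H)

theorem exists_image_val_eq_rootMultiplierSet [NeZero n]
    {G : Subgroup (GL (Fin n ⊕ Fin n) K)} (hG : IsFiniteExtensionOf G (SP n K))
    (hPSP : G ≤ PSP n K) :
    ∃ p : ℕ, 0 < p ∧
      (fun g : GL (Fin n ⊕ Fin n) K => (g.val : Matrix (Fin n ⊕ Fin n) (Fin n ⊕ Fin n) K)) ''
        (G : Set (GL (Fin n ⊕ Fin n) K)) = rootMultiplierSet n K p := by
  obtain ⟨hle, hfin⟩ := hG
  obtain ⟨m, hm⟩ := exists_similitudeMultiplier n K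
  have hSP (g : PSP n K) : m g = 1 ↔ g.1 ∈ SP n K := by
    rw [mem_SP, hm, Units.ext_iff, Units.val_one]
    refine ⟨fun h => by rw [h, one_smul], fun h => smul_stdJ_injective (n := n) ?_⟩
    simpa using h
  let μ : G →* Kˣ := m.comp (Subgroup.inclusion hPSP)
  have hker : μ.ker = (SP n K).subgroupOf G := by
    ext g
    exact hSP (Subgroup.inclusion hPSP g)
  have hcard : Nat.card μ.range ≠ 0 := by
    rw [← Subgroup.index_ker, hker]
    exact hfin.index_ne_zero
  have : Finite μ.range := (Nat.card_ne_zero.mp hcard).2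
  have hrange := eq_rootsOfUnity_natCard μ.range
  set p := Nat.card μ.range
  refine ⟨p, Nat.pos_of_ne_zero hcard, Set.ext fun M => ⟨?_, ?_⟩⟩
  · rintro ⟨g, hg, rfl⟩
    have hmem : μ ⟨g, hg⟩ ∈ rootsOfUnity p K := hrange ▸ ⟨_, rfl⟩
    exact ⟨μ ⟨g, hg⟩, (mem_rootsOfUnity' p _).mp hmem, hm ⟨g, hPSP hg⟩⟩
  · rintro ⟨c, hcp, hM⟩
    have hc : c ≠ 0 := by
      rintro rfl
      simp [zero_pow hcard] at hcp
    obtain ⟨x, rfl⟩ := isUnit_of_transpose_mul_stdJ_mul hc hM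
    have hx : x ∈ PSP n K := ⟨c, hc, hM⟩
    have hxc : m ⟨x, hx⟩ = Units.mk0 c hc :=
      Units.ext (smul_stdJ_injective (n := n) ((hm ⟨x, hx⟩).symm.trans hM))
    obtain ⟨g, hg⟩ : Units.mk0 c hc ∈ μ.range := by
      rw [hrange, mem_rootsOfUnity']
      exact hcp
    -- g in G has the same multiplier as x, so g⁻¹x lies in SP ≤ G.
    have hgx : m ((Subgroup.inclusion hPSP g)⁻¹ * ⟨x, hx⟩) = 1 := by
      rw [map_mul, map_inv, hxc, ← hg]
      exact inv_mul_cancel (m (Subgroup.inclusion hPSP g))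
    rw [hSP, Subgroup.coe_mul, Subgroup.coe_inv, Subgroup.coe_inclusion] at hgx
    have hxG : g.1 * (g.1⁻¹ * x) ∈ G := G.mul_mem g.2 (hle hgx)
    rw [mul_inv_cancel_left] at hxG
    exact ⟨x, hxG, rfl⟩

end Symplectic

theorem mainTheorem9 {K : Type*} [Field K] [IsAlgClosed K]
    (G : Subgroup (GL (Fin 2 ⊕ Fin 2) K)) (hG : IsAlgebraicSubgroup G)
    (hfin : IsFiniteExtensionOf G (SP 2 K)) :
    (∃ p : ℕ, 0 < p ∧
      (fun g : GL (Fin 2 ⊕ Fin 2) K => (g.val : Matrix (Fin 2 ⊕ Fin 2) (Fin 2 ⊕ Fin 2) K)) ''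
        (G : Set (GL (Fin 2 ⊕ Fin 2) K)) = rootMultiplierSet 2 K p) ∧
    G ≤ PSP 2 K := by
  have : Infinite K := IsAlgClosed.instInfinite
  have hPSP := le_PSP_of_isFiniteExtensionOf hfin
  exact ⟨exists_image_val_eq_rootMultiplierSet hfin hPSP, hPSP⟩
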